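/- A network is a finite directed acyclic graph $G=(V,E)$, parallel edges allowed, in which every edge has unit capacity. A two-unicast instance $\langle G,\{s_1-t_1,s_2-t_2\},\{R_1,R_2\}\rangle$ consists of a network, source nodes $s_1,s_2$ without incoming edges, terminal nodes $t_1,t_2$ without outgoing edges, and integer rates $R_1,R_2$. Source $s_i$ observes symbols $X_{i1},\dots,X_{iR_i}$ from a finite field $\mathbb F$. In a scalar linear network code over $\mathbb F$, the signal on each edge is one symbol of $\mathbb F$, namely a fixed $\mathbb F$-linear combination of the symbols observed at its tail (if the tail is a source) or of the signals on the edges entering its tail (otherwise). The code is a scalar linear network coding solution if, for $i=1,2$ and all values of the source symbols, $t_i$ can recover $X_{i1},\dots,X_{iR_i}$ from the signals on the edges entering $t_i$. The connectivity level of the instance is the vector $[\text{max-flow}(s_1-t_1)\ \ \text{max-flow}(s_2-t_2)]$. The instance is minimal if the removal of any edge of $G$ reduces the connectivity level, that is, strictly decreases at least one of its entries. Lemma. Let $m\ge 0$ be an integer, and let $\langle G,\{s_1-t_1,s_2-t_2\},\{1,m\}\rangle$ be a minimal instance with connectivity level $[1\ \ m+1]$. Then the instance has a scalar linear network coding solution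 over every sufficiently large finite field: there is $q_0$, which may depend on the instance, such that for every finite field $\mathbb F$ with $|\mathbb F|\ge q_0$ the instance has a scalar linear network coding solution over $\mathbb F$. -/

import Mathlib

/-- A finite directed network: nodes `V`, edges `E`, every edge having a tail and a head.
Parallel edges are allowed; each edge has unit capacity. -/
structure Network (V E : Type*) where
  tail : E → V
  head : E → V

namespace Network

variable {V E : Type*}

/-- There is no directed cycle. -/
def IsAcyclic (G : Network V E) : Prop :=
  ∀ v : V, ¬ Relation.TransGen (fun u w => ∃ e, G.tail e = u ∧ G.head e = w) v v

/-- The network obtained by removing the edge `e`. -/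
def deleteEdge (G : Network V E) (e : E) : Network V {e' : E // e' ≠ e} where
  tail e' := G.tail e'
  head e' := G.head e'

open Classical in
/-- The edges entering `v`. -/
noncomputable def inEdges [Fintype E] (G : Network V E) (v : V) : Finset E :=
  Finset.univ.filter fun e => G.head e = v

open Classical in
/-- The edges leaving `v`. -/
noncomputable def outEdges [Fintype E] (G : Network V E) (v : V) : Finset E :=
  Finset.univ.filter fun e => G.tail e = v

/-- `φ` is a flow from `s` to `t`: it respects the unit capacities and is conserved at every
node other than `s` and `t`. -/
structure IsFlow [Fintype E] (G : Network V E) (s t : V) (φ : E → ℝ) : Prop where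
  nonneg : ∀ e, 0 ≤ φ e
  le_one : ∀ e, φ e ≤ 1
  conserved : ∀ v, v ≠ s → v ≠ t → ∑ e ∈ G.inEdges v, φ e = ∑ e ∈ G.outEdges v, φ e

/-- The value of a flow with origin `s`: the net amount leaving `s`. -/
noncomputable def flowValue [Fintype E] (G : Network V E) (s : V) (φ : E → ℝ) : ℝ :=
  ∑ e ∈ G.outEdges s, φ e - ∑ e ∈ G.inEdges s, φ e

/-- The maximum flow from `s` to `t`. (The set of flow values is nonempty and bounded above
by the number of edges.) -/
noncomputable def maxFlow [Fintype E] (G : Network V E) (s t : V) : ℝ :=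
  sSup {r : ℝ | ∃ φ : E → ℝ, G.IsFlow s t φ ∧ G.flowValue s φ = r}

/-- The connectivity level of the source-terminal pairs `s i`, `t i`. -/
noncomputable def connectivityLevel [Fintype E] (G : Network V E) {n : ℕ}
    (s t : Fin n → V) : Fin n → ℝ :=
  fun i => G.maxFlow (s i) (t i)

end Network

/-- A multiple unicast instance with `n` sessions: a directed acyclic network, source-terminal
pairs `s i`, `t i`, where sources have no incoming and terminals no outgoing edges, and
the integer rate `R i` of each session. -/
structure MultipleUnicast (V E : Type*) (n : ℕ) extends Network V E where
  acyclic : toNetwork.IsAcyclic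
  s : Fin n → V
  t : Fin n → V
  head_ne_source : ∀ e i, head e ≠ s i
  tail_ne_terminal : ∀ e i, tail e ≠ t i
  R : Fin n → ℕ

namespace MultipleUnicast

variable {V E : Type*} {n : ℕ}

/-- The connectivity level of an instance. -/
noncomputable def connectivityLevel [Fintype E] (I : MultipleUnicast V E n) : Fin n → ℝ :=
  I.toNetwork.connectivityLevel I.s I.t

open Classical in
/-- The instance is minimal: the removal of any edge reduces the connectivity level (no entry
increases and some entry strictly decreases). -/
def IsMinimal [Fintype E] (I : MultipleUnicast V E n) : Prop :=
  ∀ e : E, (I.toNetwork.deleteEdge e).connectivityLevel I.s I.t < I.connectivityLevel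

/-- The source symbols: `X i j` is the `j`-th symbol observed at the source `s i`. -/
abbrev Messages (I : MultipleUnicast V E n) (F : Type*) : Type _ :=
  (i : Fin n) → Fin (I.R i) → F

/-- The local coefficients of a scalar linear network code: `a i j e` is the coefficient of the
source symbol `X i j` on the edge `e`, which vanishes if this symbol is not observed at the tail
of `e`, and `f e' e` is the coefficient of the signal of `e'` on the edge `e`
(used only if `e'` enters the tail of `e`). -/
structure ScalarLinearCode (I : MultipleUnicast V E n) (F : Type*) [Field F] where
  a : (i : Fin n) → Fin (I.R i) → E → F
  f : E → E → F
  a_eq_zero : ∀ i j e, I.s i ≠ I.tail e → a i j e = 0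

/-- `Y` gives the signals on the edges when the source symbols are `X`. At a source the second
sum is empty, at any other node the first sum vanishes. As the network is acyclic, `Y` is
determined by `X`. -/
def ScalarLinearCode.IsSignal [Fintype E] {I : MultipleUnicast V E n} {F : Type*} [Field F]
    (C : I.ScalarLinearCode F) (X : I.Messages F) (Y : E → F) : Prop :=
  ∀ e : E, Y e = ∑ i, ∑ j, C.a i j e * X i j + ∑ e' ∈ I.inEdges (I.tail e), C.f e' e * Y e'

/-- The instance has a scalar linear network coding solution over `F`: for some scalar linear
code, every terminal `t i` recovers all the symbols of the source `s i` from the signals on the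
edges that enter `t i`. -/
def HasScalarLinearSolution [Fintype E] (I : MultipleUnicast V E n) (F : Type*) [Field F] :
    Prop :=
  ∃ (C : I.ScalarLinearCode F) (Y : I.Messages F → E → F), (∀ X, C.IsSignal X (Y X)) ∧
    ∀ i : Fin n, ∃ decode : ((I.inEdges (I.t i)) → F) → Fin (I.R i) → F,
      ∀ X : I.Messages F, decode (fun e => Y X e) = X i

end MultipleUnicast

/-! Integral flows provide a path P from s₁ to t₁ and m + 1 edge-disjoint paths A from s₂ to t₂. Let
s₁ send x along P and s₂ a free symbol along each path of A; y collects these symbols. Where a path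
of A first meets P, the shared edge carries the sum of both signals; on later shared edges of that
path, the signal of A overwrites that of P.

Every edge of P then carries x with coefficient 1 (`eq_one`), so t₁ receives x + β(y) with β linear,
and s₂ precodes its m symbols into the kernel of β, which has dimension at least m.

For t₂, linearity leaves one claim: if all signals of A vanish at t₂, then y = 0 (`eq_zero`). After
first contact a path of A only copies, so every shared edge carries 0. If x ≠ 0, reading P back from
t₁ shows that it avoids A; if x = 0, all of P carries 0. Either way P adds nothing to A, and y
reaches t₂ unchanged. -/

namespace Network

variable {V E : Type*}

/-! ### Cuts, augmentation and integrality of flows -/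

/-- Summing the net outflow over a set of nodes, edges inside the set cancel. -/
theorem sum_net_eq [Fintype E] (G : Network V E) (φ : E → ℝ) (S : Finset V) [DecidableEq V] :
    ∑ v ∈ S, G.flowValue v φ =
      ∑ e, φ e * ((if G.tail e ∈ S then 1 else 0) - (if G.head e ∈ S then 1 else 0)) := by
  classical
  simp only [flowValue, Finset.sum_sub_distrib, mul_sub, outEdges, inEdges, Finset.sum_filter]
  congr 1 <;> rw [Finset.sum_comm] <;> refine Finset.sum_congr rfl fun e _ => ?_ <;>
    simp only [mul_ite, mul_one, mul_zero] <;> convert Finset.sum_ite_eq S _ fun _ => φ e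

theorem IsFlow.flowValue_eq_zero [Fintype E] {G : Network V E} {s t v : V} {φ : E → ℝ}
    (h : G.IsFlow s t φ) (hs : v ≠ s) (ht : v ≠ t) : G.flowValue v φ = 0 := by
  rw [flowValue, h.conserved v hs ht, sub_self]

theorem IsFlow.sum_net_of_cut [Fintype E] {G : Network V E} {s t : V} {φ : E → ℝ}
    (h : G.IsFlow s t φ) {S : Finset V} (hs : s ∈ S) (ht : t ∉ S) :
    ∑ v ∈ S, G.flowValue v φ = G.flowValue s φ :=
  Finset.sum_eq_single_of_mem s hs fun _ hv hvs =>
    h.flowValue_eq_zero hvs fun hvt => ht (hvt ▸ hv)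

open Classical in
/-- The maximum flow is bounded by the capacity of every cut. -/
theorem maxFlow_le_cut [Fintype E] (G : Network V E) {s t : V} {S : Finset V}
    (hs : s ∈ S) (ht : t ∉ S) :
    G.maxFlow s t ≤ ∑ e, if G.tail e ∈ S ∧ G.head e ∉ S then (1 : ℝ) else 0 := by
  refine Real.sSup_le ?_ (Finset.sum_nonneg fun e _ => by split_ifs <;> norm_num)
  rintro r ⟨φ, hφ, rfl⟩
  rw [← hφ.sum_net_of_cut hs ht, sum_net_eq]
  refine Finset.sum_le_sum fun e _ => ?_
  have := hφ.nonneg e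
  have := hφ.le_one e
  by_cases h1 : G.tail e ∈ S <;> by_cases h2 : G.head e ∈ S <;> simp [h1, h2] <;> linarith

open Classical in
/-- Changing a flow on one edge changes the net outflow at the ends of the edge only. -/
theorem flowValue_update [Fintype E] (G : Network V E) (φ : E → ℝ) (e : E) (c : ℝ) (v : V) :
    G.flowValue v (Function.update φ e c) = G.flowValue v φ +
      (c - φ e) * ((if v = G.tail e then 1 else 0) - (if v = G.head e then 1 else 0)) := by
  have key : ∀ p : E → Prop, ∑ x with p x, Function.update φ e c x =
      ∑ x with p x, φ x + (c - φ e) * (if p e then 1 else 0) := by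
    intro p
    simp only [Finset.sum_filter]
    rw [← Finset.add_sum_erase _ _ (Finset.mem_univ e),
      ← Finset.add_sum_erase (a := e) _ (fun x => if p x then φ x else 0) (Finset.mem_univ e),
      Finset.sum_congr rfl (g := fun x => if p x then φ x else 0)]
    · by_cases h : p e <;> simp [h]; ring
    · intro x hx
      rw [Function.update_of_ne (Finset.ne_of_mem_erase hx)]
  rw [flowValue, outEdges, inEdges, key, key, flowValue, outEdges, inEdges]
  simp only [eq_comm (a := v)]
  ring

/-- If an integral flow does not saturate any cut, it can be augmented. -/
theorem exists_augmentation [Fintype V] [Fintype E] (G : Network V E) {s t : V} (hst : s ≠ t)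
    {φ : E → ℝ} (hφ : G.IsFlow s t φ) (h01 : ∀ e, φ e = 0 ∨ φ e = 1)
    (hlt : G.flowValue s φ < G.maxFlow s t) :
    ∃ ψ : E → ℝ, G.IsFlow s t ψ ∧ (∀ e, ψ e = 0 ∨ ψ e = 1) ∧
      G.flowValue s ψ = G.flowValue s φ + 1 := by
  classical
  -- One extra unit can be brought from `s` to each node of `B` by changes inside `B` only, so edges
  -- on the boundary of `B` keep their value under `φ` and remain free for the next extension.
  let Good : Finset V → Prop := fun B => s ∈ B ∧ ∀ v ∈ B, ∃ ψ : E → ℝ,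
    (∀ e, ψ e = 0 ∨ ψ e = 1) ∧ (∀ e, ¬ (G.tail e ∈ B ∧ G.head e ∈ B) → ψ e = φ e) ∧
    ∀ u, G.flowValue u ψ =
      G.flowValue u φ + (if u = s then 1 else 0) - (if u = v then 1 else 0)
  have hgood : Good {s} := by
    refine ⟨by simp, fun v hv => ⟨φ, h01, fun _ _ => rfl, fun u => ?_⟩⟩
    rw [Finset.mem_singleton.mp hv]; ring
  obtain ⟨B, hB, hmax⟩ := (Set.toFinite {B | Good B}).exists_maximal ⟨_, hgood⟩
  -- Maximality excludes both an empty edge leaving `B` (`c = 1`) and a full edge entering it (`c =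
  -- 0`). If `t` is not in `B`, the cut is therefore saturated.
  have hext : ∀ (e : E) (u v : V) (c : ℝ), u ∈ B → v ∉ B → (c = 0 ∨ c = 1) →
      (G.tail e = u ∧ G.head e = v ∨ G.tail e = v ∧ G.head e = u) →
      (∀ w, (c - φ e) * ((if w = G.tail e then 1 else 0) - (if w = G.head e then 1 else 0)) =
        (if w = u then 1 else 0) - (if w = v then 1 else 0)) → False := by
    intro e u v c hu hv hc hve hnet
    have : Good (insert v B) := by
      refine ⟨Finset.mem_insert_of_mem hB.1, fun w hw => ?_⟩
      rcases Finset.mem_insert.mp hw with rfl | hw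
      · obtain ⟨ψ, h1, h2, h3⟩ := hB.2 u hu
        refine ⟨Function.update ψ e c, fun x => ?_, fun x hx => ?_, fun x => ?_⟩
        · by_cases hxe : x = e
          · subst hxe; simpa using hc
          · simpa [hxe] using h1 x
        · have hxe : x ≠ e := by
            rintro rfl
            rcases hve with ⟨rfl, rfl⟩ | ⟨rfl, rfl⟩
            · exact hx ⟨Finset.mem_insert_of_mem hu, Finset.mem_insert_self _ _⟩
            · exact hx ⟨Finset.mem_insert_self _ _, Finset.mem_insert_of_mem hu⟩
          rw [Function.update_of_ne hxe]
          exact h2 x fun h => hx ⟨Finset.mem_insert_of_mem h.1, Finset.mem_insert_of_mem h.2⟩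
        · have he : ψ e = φ e := h2 e fun h => by
            rcases hve with ⟨-, rfl⟩ | ⟨rfl, -⟩
            exacts [hv h.2, hv h.1]
          rw [flowValue_update, h3, he, hnet]; ring
      · obtain ⟨ψ, h1, h2, h3⟩ := hB.2 w hw
        exact ⟨ψ, h1, fun x hx => h2 x fun h =>
          hx ⟨Finset.mem_insert_of_mem h.1, Finset.mem_insert_of_mem h.2⟩, h3⟩
    exact hv (hmax this (Finset.subset_insert v B) (Finset.mem_insert_self v B))
  by_cases htB : t ∈ B
  · obtain ⟨ψ, h1, -, h3⟩ := hB.2 t htB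
    refine ⟨ψ, ⟨fun e => ?_, fun e => ?_, fun v hs ht => ?_⟩, h1, ?_⟩
    · rcases h1 e with h | h <;> simp [h]
    · rcases h1 e with h | h <;> simp [h]
    · have := h3 v
      rw [hφ.flowValue_eq_zero hs ht, flowValue] at this
      simp [hs, ht] at this
      linarith
    · simp [h3, hst]
  · exfalso
    refine absurd (G.maxFlow_le_cut hB.1 htB) (not_le.mpr (lt_of_eq_of_lt ?_ hlt))
    rw [← hφ.sum_net_of_cut hB.1 htB, sum_net_eq]
    refine Finset.sum_congr rfl fun e _ => ?_
    by_cases ht : G.tail e ∈ B <;> by_cases hh : G.head e ∈ B <;> simp only [ht, hh] <;> simp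
    · rcases h01 e with h | h
      · exact (hext e _ _ 1 ht hh (.inr rfl) (.inl ⟨rfl, rfl⟩) fun w => by rw [h]; ring).elim
      · exact h.symm
    · rcases h01 e with h | h
      · exact h
      · exact (hext e _ _ 0 hh ht (.inl rfl) (.inr ⟨rfl, rfl⟩) fun w => by rw [h]; ring).elim

/-- Integrality of the maximum flow. -/
theorem exists_integral_flow [Fintype V] [Fintype E] (G : Network V E) {s t : V} (hst : s ≠ t)
    (k : ℕ) (hk : (k : ℝ) ≤ G.maxFlow s t) :
    ∃ φ : E → ℝ, G.IsFlow s t φ ∧ (∀ e, φ e = 0 ∨ φ e = 1) ∧ G.flowValue s φ = k := by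
  induction k with
  | zero =>
    exact ⟨0, ⟨by simp, by simp, by simp⟩, by simp, by simp [flowValue]⟩
  | succ k ih =>
    push_cast at hk
    obtain ⟨φ, h1, h2, h3⟩ := ih (by linarith)
    obtain ⟨ψ, h4, h5, h6⟩ := G.exists_augmentation hst h1 h2 (by linarith)
    exact ⟨ψ, h4, h5, by rw [h6, h3]; push_cast; rfl⟩

/-! ### Edge-disjoint paths from integral flows -/

/-- A system of edge-disjoint paths from `s` to `t` that uses the edges `A`: the edge `e` is
preceded by `pred e` on its path. -/
structure IsPathSystem (G : Network V E) (s t : V) (k : ℕ) (A : Set E) (pred : E → E) :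
    Prop where
  pred_mem : ∀ e ∈ A, G.tail e ≠ s → pred e ∈ A
  head_pred : ∀ e ∈ A, G.tail e ≠ s → G.head (pred e) = G.tail e
  exists_succ : ∀ e ∈ A, G.head e ≠ t → ∃ e' ∈ A, G.tail e' = G.head e ∧ pred e' = e
  card_out : {e ∈ A | G.tail e = s}.ncard = k
  card_in : {e ∈ A | G.head e = t}.ncard = k

/-- If `s` has no incoming and `t` no outgoing edges, then a flow of value `k` from `s` to `t`
gives `k` edge-disjoint paths. -/
theorem exists_isPathSystem [Fintype V] [Fintype E] (G : Network V E) {s t : V} (k : ℕ)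
    (hk : (k : ℝ) ≤ G.maxFlow s t) (hpos : 0 < k) (hs : ∀ e, G.head e ≠ s)
    (ht : ∀ e, G.tail e ≠ t) : ∃ A pred, G.IsPathSystem s t k A pred := by
  classical
  have hst : s ≠ t := by
    rintro rfl
    have : G.maxFlow s s ≤ 0 := by
      refine Real.sSup_le ?_ le_rfl
      rintro r ⟨φ, -, rfl⟩
      simp [flowValue, outEdges, inEdges, hs, ht]
    have : (0 : ℝ) < k := by exact_mod_cast hpos
    linarith
  obtain ⟨φ, hφ, h01, hval⟩ := G.exists_integral_flow hst k hk
  let A : Finset E := {e | φ e = 1}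
  have hsum : ∀ B : Finset E, ∑ e ∈ B, φ e = ((B.filter (· ∈ A)).card : ℝ) := by
    intro B
    rw [Finset.card_filter]
    push_cast
    refine Finset.sum_congr rfl fun e _ => ?_
    rcases h01 e with h | h <;> simp [A, h]
  -- Conservation makes the used edges into and out of an inner node equinumerous; any bijection
  -- between them serves to link the paths.
  have hpair : ∀ v, v ≠ s → v ≠ t →
      Nonempty ({e // e ∈ (G.outEdges v).filter (· ∈ A)} ≃
        {e // e ∈ (G.inEdges v).filter (· ∈ A)}) := by
    intro v h1 h2
    have := hφ.conserved v h1 h2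
    rw [hsum, hsum] at this
    exact ⟨Finset.equivOfCardEq (by exact_mod_cast this.symm)⟩
  let σ := fun v (h : v ≠ s ∧ v ≠ t) => (hpair v h.1 h.2).some
  have hmem : ∀ e ∈ A, e ∈ (G.outEdges (G.tail e)).filter (· ∈ A) := by
    intro e he; simp [outEdges, he]
  let pred : E → E := fun e =>
    if h : e ∈ A ∧ G.tail e ≠ s then
      (σ (G.tail e) ⟨h.2, ht e⟩ ⟨e, hmem e h.1⟩ : E) else e
  have hpred : ∀ e ∈ A, G.tail e ≠ s →
      pred e ∈ (G.inEdges (G.tail e)).filter (· ∈ A) := by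
    intro e he hes
    simp only [pred, dif_pos (show e ∈ A ∧ G.tail e ≠ s from ⟨he, hes⟩)]
    exact (σ (G.tail e) ⟨hes, ht e⟩ ⟨e, hmem e he⟩).2
  have hout : G.flowValue s φ = ∑ e ∈ G.outEdges s, φ e := by simp [flowValue, inEdges, hs]
  have hin : G.flowValue t φ = - ∑ e ∈ G.inEdges t, φ e := by simp [flowValue, outEdges, ht]
  have htot : G.flowValue s φ + G.flowValue t φ = 0 := by
    have h := G.sum_net_eq φ Finset.univ
    rw [← Finset.sum_subset (Finset.subset_univ {s, t}), Finset.sum_pair hst] at h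
    · simpa using h
    · intro v _ hv
      simp only [Finset.mem_insert, Finset.mem_singleton, not_or] at hv
      exact hφ.flowValue_eq_zero hv.1 hv.2
  refine ⟨A, pred, fun e he hes => ?_, fun e he hes => ?_, fun e he het => ?_, ?_, ?_⟩
  · exact (Finset.mem_filter.mp (hpred e he hes)).2
  · simpa [inEdges] using (Finset.mem_filter.mp (hpred e he hes)).1
  · have hv : G.head e ≠ s ∧ G.head e ≠ t := ⟨hs e, het⟩
    obtain ⟨⟨e', he'⟩, h⟩ := (σ _ hv).surjective ⟨e, by simp [inEdges]; exact he⟩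
    obtain ⟨h1, h2⟩ : G.tail e' = G.head e ∧ e' ∈ A := by simpa [outEdges] using he'
    refine ⟨e', h2, h1, ?_⟩
    have h3 : e' ∈ A ∧ G.tail e' ≠ s := ⟨h2, h1 ▸ hs e⟩
    simp only [pred, dif_pos h3]
    -- The type of `σ v` depends on `v`, so the node is generalized before being identified with
    -- `G.head e`.
    have : ∀ v (hv' : v ≠ s ∧ v ≠ t) (hm : e' ∈ (G.outEdges v).filter (· ∈ A)),
        v = G.head e → (σ v hv' ⟨e', hm⟩ : E) = e := by
      rintro v hv' hm rfl
      rw [h]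
    exact this _ ⟨h3.2, ht e'⟩ (hmem e' h2) h1
  · have h : {e | e ∈ (A : Set E) ∧ G.tail e = s} = ((G.outEdges s).filter (· ∈ A) : Finset E) := by
      ext e; simp [outEdges, and_comm]
    rw [h, Set.ncard_coe_finset]
    rw [hout, hsum] at hval
    exact_mod_cast hval
  · have h : {e | e ∈ (A : Set E) ∧ G.head e = t} = ((G.inEdges t).filter (· ∈ A) : Finset E) := by
      ext e; simp [inEdges, and_comm]
    rw [h, Set.ncard_coe_finset]
    rw [hval, hin, hsum] at htot
    have : (k : ℝ) = (((G.inEdges t).filter (· ∈ A)).card : ℝ) := by linarith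
    exact_mod_cast this.symm

end Network

/-- A linear functional on `S → F` vanishes on the range of an injective linear map from a space
of dimension `#S - 1`. -/
theorem exists_injective_comp_eq_zero {F S : Type*} [Field F] [Fintype S] {r : ℕ}
    (hr : r + 1 = Fintype.card S) (β : (S → F) →ₗ[F] F) :
    ∃ W : (Fin r → F) →ₗ[F] (S → F), Function.Injective W ∧ β ∘ₗ W = 0 := by
  have h1 := LinearMap.finrank_range_add_finrank_ker β
  have h2 : Module.finrank F (LinearMap.range β) ≤ 1 := by
    simpa using Submodule.finrank_le (LinearMap.range β)
  rw [Module.finrank_fintype_fun_eq_card, ← hr] at h1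
  obtain ⟨b, hb⟩ := exists_linearIndependent_of_le_finrank
    (R := F) (M := LinearMap.ker β) (n := r) (by omega)
  refine ⟨(LinearMap.ker β).subtype ∘ₗ Fintype.linearCombination F b, ?_, ?_⟩
  · exact Subtype.val_injective.comp
      hb.fintypeLinearCombination_injective
  · ext; simp

/-! ### Induction along edges and the code built from the paths -/

namespace Network

variable {V E : Type*}

/-- The edge `e'` ends where the edge `e` begins. -/
def Precedes (G : Network V E) (e' e : E) : Prop := G.head e' = G.tail e

theorem IsAcyclic.irrefl_transGen_precedes {G : Network V E} (h : G.IsAcyclic) (e : E) :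
    ¬ Relation.TransGen G.Precedes e e := fun he =>
  h (G.tail e) (he.lift G.tail (fun a _ hab => ⟨a, rfl, hab⟩))

theorem IsAcyclic.wellFounded_precedes [Finite E] {G : Network V E} (h : G.IsAcyclic) :
    WellFounded G.Precedes := by
  have : Std.Irrefl (Relation.TransGen G.Precedes) := ⟨h.irrefl_transGen_precedes⟩
  exact Subrelation.wf Relation.TransGen.single
    (Finite.wellFounded_of_trans_of_irrefl (Relation.TransGen G.Precedes))

theorem IsAcyclic.wellFounded_flip_precedes [Finite E] {G : Network V E} (h : G.IsAcyclic) :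
    WellFounded (flip G.Precedes) := by
  have : Std.Irrefl (flip (Relation.TransGen G.Precedes)) := ⟨h.irrefl_transGen_precedes⟩
  have : IsTrans E (flip (Relation.TransGen G.Precedes)) := ⟨fun _ _ _ h1 h2 => h2.trans h1⟩
  exact Subrelation.wf (r := flip (Relation.TransGen G.Precedes))
    (fun h => Relation.TransGen.single h)
    (Finite.wellFounded_of_trans_of_irrefl _)

/-- In an acyclic network, local coefficients determine global coding functionals. -/
theorem IsAcyclic.exists_global_coding [Fintype E] {G : Network V E} (h : G.IsAcyclic)
    {F M : Type*} [Field F] [AddCommGroup M] [Module F M] (b : E → M →ₗ[F] F) (f : E → E → F) :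
    ∃ Y : E → M →ₗ[F] F, ∀ e, Y e = b e + ∑ e' ∈ G.inEdges (G.tail e), f e' e • Y e' := by
  classical
  have hin : ∀ e (x : G.inEdges (G.tail e)), G.Precedes x e := fun e x => by
    simpa [inEdges, Precedes] using x.2
  refine ⟨h.wellFounded_precedes.fix fun e rec =>
    b e + ∑ x : G.inEdges (G.tail e), f x e • rec x (hin e x), fun e => ?_⟩
  rw [WellFounded.fix_eq, ← Finset.sum_coe_sort (G.inEdges (G.tail e))]

variable {G : Network V E} {s₁ t₁ s₂ t₂ : V} {P A : Set E} {π α : E → E}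

/-- The path through `e` in the path system `A` meets `P` at `e` or before. -/
inductive Touched (G : Network V E) (s₂ : V) (P A : Set E) (α : E → E) : E → Prop
  | of_mem {e : E} : e ∈ P → e ∈ A → Touched G s₂ P A α e
  | step {e : E} : e ∈ A → G.tail e ≠ s₂ → Touched G s₂ P A α (α e) → Touched G s₂ P A α e

/-- The edges of `P` that carry the signal of the preceding edge of `P` (or the symbol of the
source of `P`): those outside `A`, and those at which a path of `A` meets `P` for the first time. -/
def Forwards (G : Network V E) (s₂ : V) (P A : Set E) (α : E → E) (e : E) : Prop :=
  e ∈ P ∧ (e ∈ A → G.tail e = s₂ ∨ ¬ Touched G s₂ P A α (α e))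

open Classical in
/-- The signals `Z` follow the paths of `A` and, on the edges that forward it, the path `P`. -/
def FollowsPaths {F : Type*} [Field F] (G : Network V E) (s₁ s₂ : V) (P A : Set E) (π α : E → E)
    (x : F) (y : E → F) (Z : E → F) : Prop :=
  ∀ e, Z e = (if e ∈ A then if G.tail e = s₂ then y e else Z (α e) else 0) +
    (if Forwards G s₂ P A α e then if G.tail e = s₁ then x else Z (π e) else 0)

/-! ### What the terminals receive -/

namespace FollowsPaths

variable {F : Type*} [Field F] {x : F} {y Z : E → F}

open Classical in
theorem apply_of_mem_of_notMem (h : FollowsPaths G s₁ s₂ P A π α x y Z) {e : E} (hP : e ∈ P)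
    (hA : e ∉ A) : Z e = if G.tail e = s₁ then x else Z (π e) := by
  rw [h e, if_neg hA, if_pos ⟨hP, fun h => absurd h hA⟩, zero_add]

open Classical in
theorem apply_of_not_forwards (h : FollowsPaths G s₁ s₂ P A π α x y Z) {e : E} (hA : e ∈ A)
    (hf : ¬ Forwards G s₂ P A α e) : Z e = if G.tail e = s₂ then y e else Z (α e) := by
  rw [h e, if_pos hA, if_neg hf, add_zero]

open Classical in
/-- The symbol of the source of `P` arrives with coefficient one. -/
theorem eq_one [Finite E] (hG : G.IsAcyclic) {k l : ℕ} (hP : G.IsPathSystem s₁ t₁ l P π)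
    (hA : G.IsPathSystem s₂ t₂ k A α) (h : FollowsPaths G s₁ s₂ P A π α 1 (0 : E → F) Z) (e : E) :
    (e ∈ P → Z e = 1) ∧ (Touched G s₂ P A α e → Z e = 1) ∧
      (e ∈ A → ¬ Touched G s₂ P A α e → Z e = 0) := by
  induction e using hG.wellFounded_precedes.induction with
  | _ e ih =>
  have ihP : e ∈ P → G.tail e ≠ s₁ → Z (π e) = 1 := fun h1 h2 =>
    (ih _ (hP.head_pred e h1 h2)).1 (hP.pred_mem e h1 h2)
  have hforw : Forwards G s₂ P A α e →
      (if G.tail e = s₁ then (1 : F) else Z (π e)) = 1 := fun hf => by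
    by_cases h1 : G.tail e = s₁
    · rw [if_pos h1]
    · rw [if_neg h1, ihP hf.1 h1]
  -- At first contact A contributes 0 and P contributes 1; afterwards the 1 is copied along A.
  have htouch : Touched G s₂ P A α e → Z e = 1 := by
    intro ht
    have heA : e ∈ A := by cases ht <;> assumption
    by_cases hf : Forwards G s₂ P A α e
    · rw [h e, if_pos heA, if_pos hf, hforw hf]
      by_cases h2 : G.tail e = s₂
      · simp [h2]
      · rw [if_neg h2, (ih _ (hA.head_pred e heA h2)).2.2 (hA.pred_mem e heA h2)
          ((hf.2 heA).resolve_left h2), zero_add]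
    · have : G.tail e ≠ s₂ ∧ Touched G s₂ P A α (α e) := by
        cases ht with
        | of_mem h1 _ =>
          by_contra hc
          exact hf ⟨h1, fun _ => by tauto⟩
        | step _ h2 h3 => exact ⟨h2, h3⟩
      rw [h.apply_of_not_forwards heA hf, if_neg this.1]
      exact (ih _ (hA.head_pred e heA this.1)).2.1 this.2
  refine ⟨fun heP => ?_, htouch, fun heA ht => ?_⟩
  · by_cases heA : e ∈ A
    · exact htouch (.of_mem heP heA)
    · rw [h.apply_of_mem_of_notMem heP heA]
      exact hforw ⟨heP, fun h => absurd h heA⟩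
  · rw [h.apply_of_not_forwards heA fun hf => ht (.of_mem hf.1 heA)]
    by_cases h2 : G.tail e = s₂
    · simp [h2]
    · rw [if_neg h2]
      exact (ih _ (hA.head_pred e heA h2)).2.2 (hA.pred_mem e heA h2)
        fun ht' => ht (.step heA h2 ht')

open Classical in
/-- If the signals of `A` at its terminal vanish and `P` delivers the symbol of its source, then
the symbols sent along `A` vanish. -/
theorem eq_zero [Finite E] (hG : G.IsAcyclic) (hs₂ : ∀ e, G.head e ≠ s₂)
    (hs₁ : ∀ e, G.head e ≠ s₁) {k l : ℕ}
    (hP : G.IsPathSystem s₁ t₁ l P π) (hA : G.IsPathSystem s₂ t₂ k A α)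
    (h : FollowsPaths G s₁ s₂ P A π α x y Z) (h0 : ∀ e ∈ A, G.head e = t₂ → Z e = 0)
    (hx : ∀ e ∈ P, G.head e = t₁ → Z e = x) {e : E} (he : e ∈ A) (hes : G.tail e = s₂) :
    y e = 0 := by
  -- Past a touched edge P never enters its path of A again, so the zeros at `t₂` propagate
  -- backwards.
  have htouch : ∀ e, Touched G s₂ P A α e → Z e = 0 := by
    intro e
    induction e using hG.wellFounded_flip_precedes.induction with
    | _ e ih =>
    intro ht
    have heA : e ∈ A := by cases ht <;> assumption
    by_cases het : G.head e = t₂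
    · exact h0 e heA het
    obtain ⟨e', h1, h2, rfl⟩ := hA.exists_succ e heA het
    have hs : G.tail e' ≠ s₂ := h2 ▸ hs₂ _
    rw [← ih e' h2.symm (.step h1 hs ht), h.apply_of_not_forwards h1, if_neg hs]
    exact fun hf => (hf.2 h1).elim hs fun h => h ht
  -- Backwards from `t₁`: an edge carrying `x ≠ 0` cannot be shared, since shared edges carry 0;
  -- hence it copies its predecessor on P.
  have hback : x ≠ 0 → ∀ e ∈ P, Z e = x ∧ e ∉ A := by
    intro hx0 e
    induction e using hG.wellFounded_flip_precedes.induction with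
    | _ e ih =>
    intro heP
    suffices hZ : Z e = x from ⟨hZ, fun heA => hx0 (hZ ▸ htouch e (.of_mem heP heA))⟩
    by_cases het : G.head e = t₁
    · exact hx e heP het
    obtain ⟨e', h1, h2, rfl⟩ := hP.exists_succ e heP het
    obtain ⟨h3, h4⟩ := ih e' h2.symm h1
    rw [h.apply_of_mem_of_notMem h1 h4, if_neg (h2 ▸ hs₁ _)] at h3
    exact h3
  have hforw : ∀ e ∈ A, Forwards G s₂ P A α e →
      (if G.tail e = s₁ then x else Z (π e)) = 0 := by
    intro e heA hf
    by_cases hx0 : x = 0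
    · subst hx0
      have hzero : ∀ e ∈ P, Z e = 0 := by
        intro e
        induction e using hG.wellFounded_precedes.induction with
        | _ e ih =>
        intro heP
        by_cases heA : e ∈ A
        · exact htouch e (.of_mem heP heA)
        · rw [h.apply_of_mem_of_notMem heP heA]
          by_cases h1 : G.tail e = s₁
          · rw [if_pos h1]
          · rw [if_neg h1, ih _ (hP.head_pred e heP h1) (hP.pred_mem e heP h1)]
      by_cases h1 : G.tail e = s₁
      · rw [if_pos h1]
      · rw [if_neg h1, hzero _ (hP.pred_mem e hf.1 h1)]
    · exact absurd heA (hback hx0 e hf.1).2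
  have hval : ∀ e ∈ A, Z e = if G.tail e = s₂ then y e else Z (α e) := by
    intro e heA
    by_cases hf : Forwards G s₂ P A α e
    · rw [h e, if_pos heA, if_pos hf, hforw e heA hf, add_zero]
    · exact h.apply_of_not_forwards heA hf
  have hall : ∀ e ∈ A, Z e = 0 := by
    intro e
    induction e using hG.wellFounded_flip_precedes.induction with
    | _ e ih =>
    intro heA
    by_cases het : G.head e = t₂
    · exact h0 e heA het
    obtain ⟨e', h1, h2, rfl⟩ := hA.exists_succ e heA het
    rw [← ih e' h2.symm h1, hval e' h1, if_neg (h2 ▸ hs₂ _)]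
  rw [← hall e he, hval e he, if_pos hes]

end FollowsPaths

end Network

/-! ### Precoding and assembly of the solution -/

open Network in
/-- A two-unicast instance with rates `1` and `m` whose maximum flows are at least `1` and
`m + 1` has a scalar linear solution over every field. -/
theorem MultipleUnicast.hasScalarLinearSolution_of_maxFlow {V E : Type*} [Fintype V] [Fintype E]
    (I : MultipleUnicast V E 2) (h0 : I.R 0 = 1) (h1 : 1 ≤ I.maxFlow (I.s 0) (I.t 0))
    (h2 : (I.R 1 : ℝ) + 1 ≤ I.maxFlow (I.s 1) (I.t 1)) (F : Type*) [Field F] :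
    I.HasScalarLinearSolution F := by
  classical
  obtain ⟨P, π, hP⟩ := I.exists_isPathSystem 1 (by simpa using h1) one_pos
    (fun e => I.head_ne_source e 0) (fun e => I.tail_ne_terminal e 0)
  obtain ⟨A, α, hA⟩ := I.exists_isPathSystem (I.R 1 + 1) (by exact_mod_cast h2) (Nat.succ_pos _)
    (fun e => I.head_ne_source e 1) (fun e => I.tail_ne_terminal e 1)
  let D : E → Prop := Forwards I.toNetwork (I.s 1) P A α
  let f : E → E → F := fun e' e =>
    (if (e ∈ A ∧ I.tail e ≠ I.s 1) ∧ e' = α e then 1 else 0) +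
      (if (D e ∧ I.tail e ≠ I.s 0) ∧ e' = π e then 1 else 0)
  have hf : ∀ (Z : E → F) (e : E), ∑ e' ∈ I.inEdges (I.tail e), f e' e * Z e' =
      (if e ∈ A ∧ I.tail e ≠ I.s 1 then Z (α e) else 0) +
        (if D e ∧ I.tail e ≠ I.s 0 then Z (π e) else 0) := by
    intro Z e
    have key : ∀ (p : Prop) [Decidable p] (e₀ : E), (p → I.head e₀ = I.tail e) →
        ∑ e' ∈ I.inEdges (I.tail e), (if p ∧ e' = e₀ then (1 : F) else 0) * Z e' =
          if p then Z e₀ else 0 := by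
      intro p _ e₀ h
      by_cases hp : p
      · simp [hp, inEdges, h hp]
      · simp [hp]
    simp only [f, add_mul, Finset.sum_add_distrib]
    rw [key (e ∈ A ∧ I.tail e ≠ I.s 1) _ fun h => hA.head_pred e h.1 h.2,
      key (D e ∧ I.tail e ≠ I.s 0) _ fun h => hP.head_pred e h.1.1 h.2]
  let S : Type _ := {e // e ∈ A ∧ I.tail e = I.s 1}
  -- Before precoding, the input is `x` and a symbol `y e` for every edge; only the values of `y` on
  -- `S`, the first edges of A, enter the code.
  obtain ⟨Y, hY⟩ := I.acyclic.exists_global_coding (M := F × (E → F))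
    (fun e => (if e ∈ A ∧ I.tail e = I.s 1 then LinearMap.proj e ∘ₗ LinearMap.snd F F (E → F)
      else 0) + (if D e ∧ I.tail e = I.s 0 then LinearMap.fst F F (E → F) else 0)) f
  have hYe : ∀ e x y, Y e (x, y) = ((if e ∈ A ∧ I.tail e = I.s 1 then y e else 0) +
      (if D e ∧ I.tail e = I.s 0 then x else 0)) +
        ∑ e' ∈ I.inEdges (I.tail e), f e' e * Y e' (x, y) := by
    intro e x y
    conv_lhs => rw [hY e]
    simp [apply_ite (fun L : F × (E → F) →ₗ[F] F => L (x, y))]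
  have hfollow : ∀ x y, FollowsPaths I.toNetwork (I.s 0) (I.s 1) P A π α x y
      fun e => Y e (x, y) := by
    intro x y e
    change _ = _ + (if D e then _ else 0)
    beta_reduce
    rw [hYe, hf]
    by_cases ha : e ∈ A <;> by_cases hd : D e <;>
      rcases Classical.propComplete (I.tail e = I.s 0) with hs | hs <;>
      rcases Classical.propComplete (I.tail e = I.s 1) with hs' | hs' <;>
      simp [ha, hd, hs, hs', add_comm]
  obtain ⟨p, hp⟩ := Set.ncard_eq_one.mp hP.card_in
  have hpmem : p ∈ P ∧ I.head p = I.t 0 := by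
    have : p ∈ {e | e ∈ P ∧ I.head e = I.t 0} := hp ▸ rfl
    exact this
  have hYp : ∀ x y, Y p (x, y) = x + Y p (0, y) := by
    intro x y
    have h3 : Y p (1, 0) = 1 := ((hfollow 1 0).eq_one I.acyclic hP hA p).1 hpmem.1
    rw [show ((x, y) : F × (E → F)) = x • (1, 0) + (0, y) by simp, map_add, map_smul, h3]
    simp
  have hcard : I.R 1 + 1 = Fintype.card S := by
    rw [← hA.card_out, ← Nat.card_coe_set_eq, ← Nat.card_eq_fintype_card]
    rfl
  -- The functional is the interference of `y` at `t₁`; `W` is the precoder that cancels it.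
  obtain ⟨W, hW, hW0⟩ := exists_injective_comp_eq_zero hcard
    (Y p ∘ₗ LinearMap.inr F F (E → F) ∘ₗ Function.ExtendByZero.linearMap F (Subtype.val : S → E))
  let W' := Function.ExtendByZero.linearMap F (Subtype.val : S → E) ∘ₗ W
  have hW'0 : ∀ z, Y p (0, W' z) = 0 := fun z => LinearMap.congr_fun hW0 z
  have hW' : ∀ z, (∀ e ∈ A, I.tail e = I.s 1 → W' z e = 0) → z = 0 := by
    intro z hz
    refine (map_eq_zero_iff W hW).mp (funext fun e => ?_)
    simpa [W', Subtype.val_injective.extend_apply] using hz e.1 e.2.1 e.2.2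
  have hdecode : ∀ x z, (∀ e ∈ A, I.head e = I.t 1 → Y e (x, W' z) = 0) → z = 0 := by
    intro x z hz
    refine hW' z fun e he hes => (hfollow x (W' z)).eq_zero I.acyclic
      (fun e => I.head_ne_source e 1) (fun e => I.head_ne_source e 0) hP hA hz ?_ he hes
    intro e heP het
    obtain rfl : e = p := by
      have : e ∈ {e | e ∈ P ∧ I.head e = I.t 0} := ⟨heP, het⟩
      rwa [hp] at this
    rw [hYp, hW'0, add_zero]
  -- A decoder exists as soon as the incoming signals determine the message.
  have hfactor : ∀ i (T : I.Messages F → E → F),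
      (∀ X X', (∀ e, I.head e = I.t i → T X e = T X' e) → X i = X' i) →
      ∃ decode : ((I.inEdges (I.t i)) → F) → Fin (I.R i) → F,
        ∀ X : I.Messages F, decode (fun e => T X e) = X i := by
    intro i T h
    have hT : Function.FactorsThrough (fun X : I.Messages F => X i)
        (fun X (e : I.inEdges (I.t i)) => T X e) := fun X X' hX =>
      h X X' fun e he => congrFun hX ⟨e, by simpa [inEdges] using he⟩
    exact ⟨Function.extend (fun X (e : I.inEdges (I.t i)) => T X e) (fun X => X i) 0,
      fun X => hT.extend_apply 0 X⟩
  let a : (i : Fin 2) → Fin (I.R i) → E → F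
    | 0 => fun _ e => if D e ∧ I.tail e = I.s 0 then 1 else 0
    | 1 => fun j e => if e ∈ A ∧ I.tail e = I.s 1 then W' (fun k => if j = k then 1 else 0) e else 0
  -- As `I.R 0 = 1`, the sum over `j` is just the single symbol of the first source.
  refine ⟨⟨a, f, ?_⟩, fun X e => Y e (∑ j, X 0 j, W' (X 1)), fun X e => ?_, ?_⟩
  · intro i j e hne
    fin_cases i
    · exact if_neg fun h => hne h.2.symm
    · exact if_neg fun h => hne h.2.symm
  · have hsum : W' (X 1) e = ∑ j, W' (fun k => if j = k then 1 else 0) e * X 1 j := by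
      rw [LinearMap.pi_apply_eq_sum_univ W' (X 1)]
      simp [mul_comm, Finset.sum_apply]
    beta_reduce
    rw [hYe, hsum, Fin.sum_univ_two]
    congr 1
    rw [add_comm]
    congr 1
    · change _ = ∑ j, (if D e ∧ I.tail e = I.s 0 then (1 : F) else 0) * X 0 j
      simp
    · change _ = ∑ j, (if e ∈ A ∧ I.tail e = I.s 1 then _ else (0 : F)) * X 1 j
      split_ifs <;> simp
  · intro i
    refine hfactor i (fun X e => Y e (∑ j, X 0 j, W' (X 1))) fun X X' h => ?_
    fin_cases i
    · have h3 := h p hpmem.2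
      beta_reduce at h3
      rw [hYp, hYp (∑ j, X' 0 j), hW'0, hW'0, add_zero, add_zero] at h3
      have : Subsingleton (Fin (I.R 0)) := by rw [h0]; infer_instance
      change X 0 = X' 0
      funext j
      have hj : ∀ X : I.Messages F, ∑ j, X 0 j = X 0 j := fun X =>
        Fintype.sum_subsingleton _ j
      rwa [hj, hj] at h3
    · change X 1 = X' 1
      refine sub_eq_zero.mp (hdecode (∑ j, X 0 j - ∑ j, X' 0 j) _ fun e _ he => ?_)
      rw [map_sub, ← Prod.mk_sub_mk, map_sub]
      exact sub_eq_zero.mpr (h e he)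

theorem mainTheorem5 {V E : Type*} [Fintype V] [Fintype E] (m : ℕ)
    (I : MultipleUnicast V E 2) (hR : I.R = ![1, m]) (hmin : I.IsMinimal)
    (hlevel : I.connectivityLevel = ![1, (m : ℝ) + 1]) :
    ∃ q₀ : ℕ, ∀ (F : Type*) [Field F] [Fintype F], q₀ ≤ Fintype.card F →
      I.HasScalarLinearSolution F := by
  -- The construction makes no generic choice of coefficients, so no lower bound on the field size
  -- is needed.
  refine ⟨0, fun F _ _ _ => I.hasScalarLinearSolution_of_maxFlow ?_ ?_ ?_ F⟩
  · simp [hR]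
  · exact (congrFun hlevel 0).ge
  · have : I.R 1 = m := by simp [hR]
    rw [this]
    exact (congrFun hlevel 1).ge
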